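/- For a rational number $x$ and an integer $n\ge 0$ let $(x)_n=x(x+1)\cdots(x+n-1)$, with $(x)_0=1$. For a prime $p$, two rational numbers are called congruent modulo $p^6$ if their difference is $p^6$ times a rational number whose denominator (in lowest terms) is not divisible by $p$. Let $p$ be a prime with $p\equiv 1\pmod 6$. Then \begin{align*} &\sum_{\substack{i,j\ge 0\\ i+j\le p-1}}(6i+1)(6j+1)\frac{(\frac13)_i^6(\frac13)_j^6}{(1)_i^6(1)_j^6}\\ &\quad\equiv p^2\,\frac{(\frac23)_{(p-1)/3}^2}{(1)_{(p-1)/3}^2}\left(\sum_{k=0}^{(p-1)/3}\frac{(\frac13)_k^3}{(1)_k^3}\right)\left(\sum_{k=0}^{(p-1)/3}\frac{(\frac13)_k^3}{(1)_k^3}\left\{1-2p^2\sum_{t=1}^{k}\left(\frac1{(3t-2)^2}+\frac1{(3t)^2}\right)\right\}\right)\pmod{p^6}. \end{align*} -/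

import Mathlib

/-- The shifted factorial `(x)_n = Γ(x + n) / Γ(x) = x (x + 1) ⋯ (x + n - 1)` of a rational `x`. -/
noncomputable def shiftedFactorial (x : ℚ) (n : ℕ) : ℚ := (ascPochhammer ℚ n).eval x

/-- Congruence of rational numbers modulo a natural number `N`: the difference `x - y` is `N` times
a rational number whose reduced denominator is coprime to `N`. -/
def RatModEq (N : ℕ) (x y : ℚ) : Prop :=
  ∃ z : ℚ, Nat.Coprime z.den N ∧ x - y = (N : ℚ) * z

/-! Write p = 3m + 1 and r_i = (1/3)_i/(1)_i. For m < i < p the number r_i is divisible by p, and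
the square 0 ≤ i, j ≤ m lies inside the triangle i + j ≤ p - 1. So the double sum is S² modulo p⁶,
where S = ∑_{i≤m} (6i+1) r_i⁶ (`exists_double_sum_eq`). As S is itself divisible by p, knowing it
modulo p⁵ suffices (`exists_single_sum_eq`).

To find S, four of the six parameters 1/3 are moved to 1/3 ± p/3 and 1/3 ± √-1·p/3, with matching
changes of the lower parameters. Only powers of p⁴ enter, and the p⁴ coefficient of the sum vanishes
modulo p because i ↦ m - i reverses its sign (`sum_thirdRatio_quarticSum`). The deformed sum
terminates and equals p·(2/3)_m/(1)_m times a ₄F₃ by `whipple_third`; expanding that ₄F₃ to order p²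
gives A - p²D. Finally (A - p²D)² = A(A - 2p²D) + p⁴D².

Whipple's transformation comes from a Newton expansion of one quotient (`saalschutz_third`),
followed by the evaluation of each Newton moment (`wellPoised_sum`). Conjugate parameters enter only
through their squares `Z`, so everything stays rational. -/

open Finset

/-! ### Newton basis and the Pfaff–Saalschütz summation -/

/-- `newtonProd k x = (-x)_k (x + 1/3)_k`, the Newton basis in `x (x + 1/3)` on the nodes `0, 1, 2, …`. -/
def newtonProd (k : ℕ) (x : ℚ) : ℚ := ∏ j ∈ range k, ((j : ℚ) - x) * (x + 1 / 3 + j)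

/-- `thirdSqProd Z k = ((1/3) + √Z)_k ((1/3) - √Z)_k`. -/
def thirdSqProd (Z : ℚ) (k : ℕ) : ℚ := ∏ j ∈ range k, (((j : ℚ) + 1 / 3) ^ 2 - Z)

/-- `oneSqProd Z k = (1 + √Z)_k (1 - √Z)_k`. -/
def oneSqProd (Z : ℚ) (k : ℕ) : ℚ := ∏ j ∈ range k, (((j : ℚ) + 1) ^ 2 - Z)

/-- `thirdRatio k = (1/3)_k / (1)_k`. -/
def thirdRatio (k : ℕ) : ℚ := ∏ j ∈ range k, ((j : ℚ) + 1 / 3) / (j + 1)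

/-- `twoThirdRatio k = (2/3)_k / (1)_k`. -/
def twoThirdRatio (k : ℕ) : ℚ := ∏ j ∈ range k, ((j : ℚ) + 2 / 3) / (j + 1)

lemma newtonProd_zero (x : ℚ) : newtonProd 0 x = 1 := by simp [newtonProd]

lemma newtonProd_succ (k : ℕ) (x : ℚ) :
    newtonProd (k + 1) x = newtonProd k x * ((k - x) * (x + 1 / 3 + k)) := by
  simp [newtonProd, prod_range_succ]

lemma newtonProd_eq_zero {i k : ℕ} (h : i < k) : newtonProd k i = 0 :=
  prod_eq_zero (mem_range.2 h) (by simp)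

/-- Cross-multiplied, since `x + 1 - k` may vanish at integer points. -/
lemma newtonProd_shift (k : ℕ) (x : ℚ) :
    newtonProd k (x + 1) * ((x + 1 - k) * (x + 1 / 3)) =
      newtonProd k x * ((x + 1) * (x + 1 / 3 + k)) := by
  induction k with
  | zero => simp [newtonProd_zero]
  | succ k ih =>
    rw [newtonProd_succ, newtonProd_succ]
    push_cast
    linear_combination (k - x) * (x + 1 + 1 / 3 + k) * ih

/-- The telescoping kernel `∏_{j<k} (j - x) (x + 4/3 + j)`. -/
def shiftedNewtonProd (k : ℕ) (x : ℚ) : ℚ := ∏ j ∈ range k, ((j : ℚ) - x) * (x + 4 / 3 + j)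

lemma shiftedNewtonProd_succ (k : ℕ) (x : ℚ) :
    shiftedNewtonProd (k + 1) x = shiftedNewtonProd k x * ((k - x) * (x + 4 / 3 + k)) := by
  simp [shiftedNewtonProd, prod_range_succ]

/-- With `newtonProd_succ_add_one`, this exhibits the kernel as a common factor of the Newton
products at `x` and `x + 1`. -/
lemma shiftedNewtonProd_mul_eq (k : ℕ) (x : ℚ) :
    shiftedNewtonProd k x * ((k - x) * (x + 1 / 3)) = newtonProd (k + 1) x := by
  induction k with
  | zero => simp [shiftedNewtonProd, newtonProd]
  | succ k ih =>
    rw [shiftedNewtonProd_succ, newtonProd_succ, ← ih]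
    push_cast
    ring

lemma newtonProd_succ_add_one (k : ℕ) (x : ℚ) :
    newtonProd (k + 1) (x + 1) = shiftedNewtonProd k x * (-(x + 1) * (x + 4 / 3 + k)) := by
  induction k with
  | zero =>
    rw [newtonProd_succ, newtonProd_zero, shiftedNewtonProd, prod_range_zero]
    push_cast
    ring
  | succ k ih =>
    rw [shiftedNewtonProd_succ, newtonProd_succ, ih]
    push_cast
    ring

lemma oneSqProd_succ (Z : ℚ) (k : ℕ) :
    oneSqProd Z (k + 1) = oneSqProd Z k * (((k : ℚ) + 1) ^ 2 - Z) := prod_range_succ _ _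

lemma thirdSqProd_succ (Z : ℚ) (k : ℕ) :
    thirdSqProd Z (k + 1) = thirdSqProd Z k * (((k : ℚ) + 1 / 3) ^ 2 - Z) := prod_range_succ _ _

lemma thirdRatio_succ (k : ℕ) :
    thirdRatio (k + 1) = thirdRatio k * (((k : ℚ) + 1 / 3) / (k + 1)) := prod_range_succ _ _

lemma twoThirdRatio_succ (k : ℕ) :
    twoThirdRatio (k + 1) = twoThirdRatio k * (((k : ℚ) + 2 / 3) / (k + 1)) := prod_range_succ _ _

/-- The closed form in `saalschutz_third` obeys a first-order recurrence in `i`; this shows that the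
Newton sum obeys it too, up to a boundary term that vanishes at `x = i` once `K > i`. -/
lemma saalschutz_telescope {Z : ℚ} (hZ : ∀ k : ℕ, ((k : ℚ) + 1) ^ 2 - Z ≠ 0) (x : ℚ) (K : ℕ) :
    ∑ k ∈ range (K + 1), twoThirdRatio k / oneSqProd Z k *
        (((x + 1) ^ 2 - Z) * newtonProd k (x + 1) - ((x + 1 / 3) ^ 2 - Z) * newtonProd k x) =
      (2 * x + 4 / 3) * (2 / 3 + K) * (twoThirdRatio K / oneSqProd Z K) *
        shiftedNewtonProd K x := by
  induction K with
  | zero =>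
    simp [twoThirdRatio, oneSqProd, newtonProd, shiftedNewtonProd]
    ring
  | succ K ih =>
    have h0 : oneSqProd Z K ≠ 0 := prod_ne_zero_iff.2 fun k _ => hZ k
    have h1 := hZ K
    have h2 : (K : ℚ) + 1 ≠ 0 := by positivity
    rw [sum_range_succ, ih, newtonProd_succ_add_one, ← shiftedNewtonProd_mul_eq,
      shiftedNewtonProd_succ, oneSqProd_succ, twoThirdRatio_succ]
    push_cast
    field_simp
    ring

/-- A Pfaff–Saalschütz summation. -/
lemma saalschutz_third {Z : ℚ} (hZ : ∀ k : ℕ, ((k : ℚ) + 1) ^ 2 - Z ≠ 0) (i : ℕ) :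
    ∑ k ∈ range (i + 1), twoThirdRatio k / oneSqProd Z k * newtonProd k i =
      thirdSqProd Z i / oneSqProd Z i := by
  induction i with
  | zero => simp [twoThirdRatio, oneSqProd, newtonProd, thirdSqProd]
  | succ i ih =>
    have h := saalschutz_telescope hZ (i : ℚ) (i + 1)
    have h0 : shiftedNewtonProd (i + 1) (i : ℚ) = 0 := by simp [shiftedNewtonProd_succ]
    have h1 := hZ i
    have h2 : oneSqProd Z i ≠ 0 := prod_ne_zero_iff.2 fun k _ => hZ k
    have h3 : ∑ k ∈ range (i + 1 + 1), twoThirdRatio k / oneSqProd Z k * newtonProd k i =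
        thirdSqProd Z i / oneSqProd Z i := by
      rw [sum_range_succ, ih, newtonProd_eq_zero (Nat.lt_succ_self i), mul_zero, add_zero]
    have h4 : (((i : ℚ) + 1) ^ 2 - Z) * (∑ k ∈ range (i + 1 + 1),
        twoThirdRatio k / oneSqProd Z k * newtonProd k ((i : ℚ) + 1)) =
        (((i : ℚ) + 1 / 3) ^ 2 - Z) * ∑ k ∈ range (i + 1 + 1),
        twoThirdRatio k / oneSqProd Z k * newtonProd k (i : ℚ) := by
      rw [h0, mul_zero] at h
      rw [← sub_eq_zero, mul_sum, mul_sum, ← sum_sub_distrib, ← h]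
      exact sum_congr rfl fun k _ => by ring
    rw [h3] at h4
    push_cast
    rw [← mul_right_inj' h1, h4, thirdSqProd_succ, oneSqProd_succ]
    field_simp

/-! ### Well-poised moments and Whipple's transformation -/

/-- The bracket encodes the recurrence in `k` wanted for the moments; weighted this way it is an
exact difference in `i`. The boundary term contains `thirdSqProd P n`, which vanishes for `n = m +
1` and `P = (m + 1/3)²`. -/
lemma wellPoised_telescope {P : ℚ} {n : ℕ} (hP : ∀ k < n, ((k : ℚ) + 1) ^ 2 - P ≠ 0) (k : ℕ) :
    ∑ i ∈ range n, (6 * (i : ℚ) + 1) *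
        (thirdRatio i ^ 2 * (thirdSqProd P i / oneSqProd P i)) *
        ((2 / 3 + k) * newtonProd (k + 1) i -
          (1 / 3 + k) * ((k + 1 / 3) ^ 2 - P) * newtonProd k i) =
      -3 * n * (n - k) * (n ^ 2 - P) *
        (thirdRatio n ^ 2 * (thirdSqProd P n / oneSqProd P n)) * newtonProd k n := by
  induction n with
  | zero => simp
  | succ n ih =>
    have h0 : oneSqProd P n ≠ 0 :=
      prod_ne_zero_iff.2 fun k hk => hP k ((mem_range.1 hk).trans (Nat.lt_succ_self n))
    have h1 := hP n (Nat.lt_succ_self n)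
    have h2 : (n : ℚ) + 1 ≠ 0 := by positivity
    have h3 : (n : ℚ) + 1 / 3 ≠ 0 := by positivity
    have h4 : newtonProd k ((n : ℚ) + 1) * (n + 1 - k) =
        newtonProd k n * ((n + 1) * (n + 1 / 3 + k)) / (n + 1 / 3) := by
      rw [eq_div_iff h3, ← newtonProd_shift]; ring
    rw [sum_range_succ, ih fun k hk => hP k (hk.trans (Nat.lt_succ_self n)), newtonProd_succ,
      thirdRatio_succ, thirdSqProd_succ, oneSqProd_succ]
    push_cast
    generalize hA : thirdRatio n = A
    generalize hB : newtonProd k (n : ℚ) = B at *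
    generalize hC : newtonProd k ((n : ℚ) + 1) = C at *
    generalize hD : thirdSqProd P n = D
    generalize oneSqProd P n = E at *
    have h5 : -3 * ((n : ℚ) + 1) * (n + 1 - k) * ((n + 1) ^ 2 - P) *
        ((A * ((n + 1 / 3) / (n + 1))) ^ 2 *
          (D * ((n + 1 / 3) ^ 2 - P) / (E * ((n + 1) ^ 2 - P)))) * C =
        -3 * ((n : ℚ) + 1 / 3) * (n + 1 / 3 + k) * ((n + 1 / 3) ^ 2 - P) * (A ^ 2 * (D / E)) * B := by
      rw [show -3 * ((n : ℚ) + 1) * (n + 1 - k) * ((n + 1) ^ 2 - P) *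
        ((A * ((n + 1 / 3) / (n + 1))) ^ 2 *
          (D * ((n + 1 / 3) ^ 2 - P) / (E * ((n + 1) ^ 2 - P)))) * C =
        -3 * ((n : ℚ) + 1) * ((n + 1) ^ 2 - P) *
        ((A * ((n + 1 / 3) / (n + 1))) ^ 2 *
          (D * ((n + 1 / 3) ^ 2 - P) / (E * ((n + 1) ^ 2 - P)))) * (C * (n + 1 - k)) by ring, h4]
      generalize hN : (n : ℚ) + 1 = N at *
      generalize hM : (n : ℚ) + 1 / 3 = M at *
      field_simp
    rw [h5]
    ring

/-- The factor `k + 1 - (m + 1/3)` is a third of an integer congruent to 2 modulo 3. -/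
lemma sq_sub_ne_zero (m : ℕ) (k : ℕ) : ((k : ℚ) + 1) ^ 2 - ((m : ℚ) + 1 / 3) ^ 2 ≠ 0 := by
  rw [sq_sub_sq]
  refine mul_ne_zero (by positivity) fun h => ?_
  have : (3 * ((k : ℤ) - m) + 2 : ℤ) = 0 := by
    have : (3 * ((k : ℚ) - m) + 2 : ℚ) = 0 := by linarith
    exact_mod_cast this
  omega

/-- Each difference of squares factors, and reversing `j` turns one set of factors into the
numerators of `thirdRatio m` up to sign. This evaluates the one term surviving in the moment `k =
m`. -/
lemma oneSqProd_diag (m : ℕ) :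
    (6 * (m : ℚ) + 1) * (thirdRatio m * newtonProd m m) =
      (3 * m + 1) * oneSqProd (((m : ℚ) + 1 / 3) ^ 2) m := by
  have hq : ∀ x : ℚ, ∀ n : ℕ, (x + 1 / 3 + n) * ∏ j ∈ range n, (x + 1 / 3 + j) =
      (x + 1 / 3) * ∏ j ∈ range n, (x + 4 / 3 + j) := by
    intro x n
    induction n with
    | zero => simp
    | succ n ih =>
      rw [prod_range_succ, prod_range_succ]
      push_cast
      linear_combination (x + 1 / 3 + (n + 1)) * ih
  have h1 : thirdRatio m = (∏ j ∈ range m, ((j : ℚ) + 1 / 3)) / ∏ j ∈ range m, ((j : ℚ) + 1) :=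
    prod_div_distrib _ _
  have h2 : newtonProd m m = (∏ j ∈ range m, (-((j : ℚ) + 1))) *
      ∏ j ∈ range m, ((m : ℚ) + 1 / 3 + j) := by
    rw [newtonProd, prod_mul_distrib]
    congr 1
    rw [← prod_range_reflect]
    refine prod_congr rfl fun j hj => ?_
    have := mem_range.1 hj
    rw [Nat.sub_sub, Nat.cast_sub (by omega)]
    push_cast
    ring
  have h3 : oneSqProd (((m : ℚ) + 1 / 3) ^ 2) m = (∏ j ∈ range m, (-((j : ℚ) + 1 / 3))) *
      ∏ j ∈ range m, ((m : ℚ) + 4 / 3 + j) := by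
    rw [← prod_range_reflect (fun j : ℕ => -((j : ℚ) + 1 / 3)), ← prod_mul_distrib, oneSqProd]
    refine prod_congr rfl fun j hj => ?_
    have := mem_range.1 hj
    rw [Nat.sub_sub, Nat.cast_sub (by omega)]
    push_cast
    ring
  have h4 := hq m m
  have h5 : ∏ j ∈ range m, ((j : ℚ) + 1) ≠ 0 := prod_ne_zero_iff.2 fun j _ => by positivity
  rw [h1, h2, h3, prod_neg, prod_neg]
  generalize ∏ j ∈ range m, ((j : ℚ) + 1) = a at *
  generalize ∏ j ∈ range m, ((j : ℚ) + 1 / 3) = b at *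
  generalize ∏ j ∈ range m, ((m : ℚ) + 1 / 3 + j) = c at *
  generalize ∏ j ∈ range m, ((m : ℚ) + 4 / 3 + j) = d at *
  rw [card_range, div_mul_eq_mul_div, mul_div_assoc', div_eq_iff h5]
  linear_combination 3 * b * a * (-1) ^ m * h4

/-- The very well-poised sums against the Newton basis. -/
lemma wellPoised_sum (m k : ℕ) :
    ∑ i ∈ range (m + 1), (6 * (i : ℚ) + 1) * (thirdRatio i ^ 2 *
        (thirdSqProd (((m : ℚ) + 1 / 3) ^ 2) i / oneSqProd (((m : ℚ) + 1 / 3) ^ 2) i)) *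
        newtonProd k i * twoThirdRatio k =
      (3 * m + 1) * twoThirdRatio m * (thirdRatio k * thirdSqProd (((m : ℚ) + 1 / 3) ^ 2) k) := by
  set P := ((m : ℚ) + 1 / 3) ^ 2 with hPdef
  set F : ℕ → ℚ := fun k => ∑ i ∈ range (m + 1), (6 * (i : ℚ) + 1) * (thirdRatio i ^ 2 *
        (thirdSqProd P i / oneSqProd P i)) * newtonProd k i * twoThirdRatio k with hF
  have hP : ∀ k < m + 1, ((k : ℚ) + 1) ^ 2 - P ≠ 0 := fun k _ => sq_sub_ne_zero m k
  have hrec (k : ℕ) : F (k + 1) = F k * ((k + 1 / 3) / (k + 1) * ((k + 1 / 3) ^ 2 - P)) := by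
    have h := wellPoised_telescope hP k
    have h0 : thirdSqProd P (m + 1) = 0 := by rw [thirdSqProd_succ, hPdef, sub_self, mul_zero]
    rw [h0] at h
    simp only [zero_div, mul_zero, zero_mul] at h
    have h2 : (k : ℚ) + 1 ≠ 0 := by positivity
    rw [← sub_eq_zero, hF]
    simp only
    rw [sum_mul, ← sum_sub_distrib, ← mul_zero (twoThirdRatio k / (k + 1)), ← h, mul_sum]
    refine sum_congr rfl fun i _ => ?_
    rw [twoThirdRatio_succ]
    field_simp
    ring
  have hclosed (k : ℕ) : F k = F 0 * (thirdRatio k * thirdSqProd P k) := by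
    induction k with
    | zero => simp [thirdRatio, thirdSqProd]
    | succ k ih => rw [hrec, ih, thirdRatio_succ, thirdSqProd_succ]; ring
  have hm0 : thirdRatio m * thirdSqProd P m ≠ 0 := by
    refine mul_ne_zero (prod_ne_zero_iff.2 fun j _ => by positivity)
      (prod_ne_zero_iff.2 fun j hj => ?_)
    have : (j : ℚ) < m := by exact_mod_cast mem_range.1 hj
    rw [hPdef, sq_sub_sq]
    exact mul_ne_zero (by positivity) (by linarith)
  have hD0 : oneSqProd P m ≠ 0 := prod_ne_zero_iff.2 fun k _ => sq_sub_ne_zero m k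
  -- At `k = m` the Newton product kills every `i < m`. The single remaining term then determines `F
  -- 0` through `hclosed`.
  have hbase : F m = (3 * m + 1) * twoThirdRatio m * (thirdRatio m * thirdSqProd P m) := by
    have : F m = (6 * (m : ℚ) + 1) * (thirdRatio m ^ 2 *
        (thirdSqProd P m / oneSqProd P m)) * newtonProd m m * twoThirdRatio m := by
      simp only [hF]
      rw [sum_range_succ, sum_eq_zero, zero_add]
      intro i hi
      rw [newtonProd_eq_zero (mem_range.1 hi)]
      ring
    rw [this]
    have := oneSqProd_diag m
    rw [← hPdef] at this
    field_simp
    linear_combination twoThirdRatio m * thirdSqProd P m * thirdRatio m * this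
  have hF0 : F 0 = (3 * m + 1) * twoThirdRatio m := by
    rw [hclosed m] at hbase
    exact mul_right_cancel₀ hm0 hbase
  rw [← hF0]
  exact hclosed k

/-- A special case of Whipple's transformation of a very well-poised `₇F₆` into a `₄F₃`. -/
theorem whipple_third (m : ℕ) {Z : ℚ} (hZ : ∀ k : ℕ, ((k : ℚ) + 1) ^ 2 - Z ≠ 0) :
    ∑ i ∈ range (m + 1), (6 * (i : ℚ) + 1) * (thirdRatio i ^ 2 *
        (thirdSqProd (((m : ℚ) + 1 / 3) ^ 2) i / oneSqProd (((m : ℚ) + 1 / 3) ^ 2) i)) *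
        (thirdSqProd Z i / oneSqProd Z i) =
      (3 * m + 1) * twoThirdRatio m *
        ∑ k ∈ range (m + 1), thirdRatio k * (thirdSqProd (((m : ℚ) + 1 / 3) ^ 2) k /
          oneSqProd Z k) := by
  have h (i : ℕ) (hi : i ∈ range (m + 1)) : thirdSqProd Z i / oneSqProd Z i =
      ∑ k ∈ range (m + 1), twoThirdRatio k / oneSqProd Z k * newtonProd k i := by
    rw [← saalschutz_third hZ]
    -- The Newton product vanishes for `k > i`, so the range of `k` can be made independent of `i`
    -- and the sums exchanged.
    refine sum_subset (range_mono (by simpa using hi)) fun k _ hk => ?_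
    rw [newtonProd_eq_zero (by simpa using hk), mul_zero]
  rw [sum_congr rfl fun i hi => by rw [h i hi, mul_sum], sum_comm, mul_sum]
  refine sum_congr rfl fun k _ => ?_
  have := wellPoised_sum m k
  rw [← mul_div_assoc, ← mul_div_assoc, ← this, sum_div]
  exact sum_congr rfl fun i _ => by ring

/-! ### Rationals integral at p and congruences between them -/

/-- The rational numbers whose denominator is coprime to `p`. -/
def localIntegers (p : ℕ) : Subring ℚ where
  carrier := {x | x.den.Coprime p}
  zero_mem' := by simp
  one_mem' := by simp
  add_mem' {x y} hx hy := Nat.Coprime.of_dvd_left (Rat.add_den_dvd x y) (Nat.Coprime.mul_left hx hy)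
  mul_mem' {x y} hx hy := Nat.Coprime.of_dvd_left (Rat.mul_den_dvd x y) (Nat.Coprime.mul_left hx hy)
  neg_mem' {x} hx := by simpa using hx

lemma mem_localIntegers {p : ℕ} {x : ℚ} : x ∈ localIntegers p ↔ x.den.Coprime p := Iff.rfl

lemma int_div_mem_localIntegers {p : ℕ} (a : ℤ) {b : ℤ} (hb : IsCoprime b p) :
    (a / b : ℚ) ∈ localIntegers p := by
  have h : (((a / b : ℚ).den : ℕ) : ℤ) ∣ b := by
    rw [← Rat.divInt_eq_div]; exact Rat.den_dvd a b
  exact Nat.isCoprime_iff_coprime.1 (hb.of_isCoprime_of_dvd_left h)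

lemma nat_div_mem_localIntegers {p : ℕ} (a : ℕ) {b : ℕ} (hb : b.Coprime p) :
    (a / b : ℚ) ∈ localIntegers p := by
  simpa using int_div_mem_localIntegers a (Nat.isCoprime_iff_coprime.2 hb)

/-- The numerator `s.den - p * s.num` is congruent to `s.den` modulo `p`, hence coprime to `p`. -/
lemma inv_one_sub_mem_localIntegers {p : ℕ} {s : ℚ} (hs : s ∈ localIntegers p) :
    (1 - p * s)⁻¹ ∈ localIntegers p := by
  have hd : (s.den : ℚ) ≠ 0 := by exact_mod_cast s.den_ne_zero
  have h : (1 - p * s)⁻¹ = ((s.den : ℤ) : ℚ) / ((s.den - p * s.num : ℤ) : ℚ) := by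
    have : s = s.num / s.den := (Rat.num_div_den s).symm
    rw [show (1 - p * s) = ((s.den - p * s.num : ℤ) : ℚ) / ((s.den : ℤ) : ℚ) by
      push_cast; rw [eq_div_iff hd, sub_mul, mul_assoc, Rat.mul_den_eq_num]; ring, inv_div]
  rw [h]
  refine int_div_mem_localIntegers _ ?_
  have h1 : IsCoprime (s.den : ℤ) p := Nat.isCoprime_iff_coprime.2 hs
  have := h1.add_mul_left_left (-s.num)
  rwa [mul_neg, ← sub_eq_add_neg] at this

namespace RatModEq

variable {p : ℕ} {x y x' y' z : ℚ}

lemma refl (p : ℕ) (x : ℚ) : RatModEq p x x := ⟨0, by simp, by simp⟩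

lemma trans (h : RatModEq p x y) (h' : RatModEq p y z) : RatModEq p x z := by
  obtain ⟨a, ha, e⟩ := h
  obtain ⟨b, hb, e'⟩ := h'
  exact ⟨a + b, (localIntegers p).add_mem ha hb, by linear_combination e + e'⟩

lemma symm (h : RatModEq p x y) : RatModEq p y x := by
  obtain ⟨a, ha, e⟩ := h
  exact ⟨-a, (localIntegers p).neg_mem ha, by linear_combination -e⟩

lemma add (h : RatModEq p x y) (h' : RatModEq p x' y') : RatModEq p (x + x') (y + y') := by
  obtain ⟨a, ha, e⟩ := h
  obtain ⟨b, hb, e'⟩ := h'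
  exact ⟨a + b, (localIntegers p).add_mem ha hb, by linear_combination e + e'⟩

lemma sub (h : RatModEq p x y) (h' : RatModEq p x' y') : RatModEq p (x - x') (y - y') := by
  obtain ⟨a, ha, e⟩ := h
  obtain ⟨b, hb, e'⟩ := h'
  exact ⟨a - b, (localIntegers p).sub_mem ha hb, by linear_combination e - e'⟩

lemma mul (h : RatModEq p x y) (h' : RatModEq p x' y') (hx : x ∈ localIntegers p)
    (hy' : y' ∈ localIntegers p) : RatModEq p (x * x') (y * y') := by
  obtain ⟨a, ha, e⟩ := h
  obtain ⟨b, hb, e'⟩ := h'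
  exact ⟨x * b + a * y', (localIntegers p).add_mem ((localIntegers p).mul_mem hx hb)
    ((localIntegers p).mul_mem ha hy'), by linear_combination x * e' + y' * e⟩

lemma pow (h : RatModEq p x y) (hx : x ∈ localIntegers p) (hy : y ∈ localIntegers p) (n : ℕ) :
    RatModEq p (x ^ n) (y ^ n) := by
  induction n with
  | zero => simpa using refl p 1
  | succ n ih =>
    rw [pow_succ, pow_succ]
    exact ih.mul h ((localIntegers p).pow_mem hx n) hy

end RatModEq

lemma sum_ratModEq_zero {ι : Type*} {p : ℕ} {s : Finset ι} {f : ι → ℚ}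
    (h : ∀ i ∈ s, RatModEq p (f i) 0) : RatModEq p (∑ i ∈ s, f i) 0 := by
  induction s using Finset.cons_induction with
  | empty => simpa using RatModEq.refl p 0
  | cons a s ha ih =>
    rw [sum_cons, ← add_zero (0 : ℚ)]
    exact (h a (mem_cons_self a s)).add (ih fun i hi => h i (mem_cons_of_mem hi))

/-- First order expansion of a product of quotients. -/
lemma exists_prod_div_eq (R : Subring ℚ) {w : ℚ} (hw : w ∈ R) {x y : ℕ → ℚ} {k : ℕ}
    (hx : ∀ j < k, x j ∈ R) (hy : ∀ j < k, y j ∈ R) (hinv : ∀ j < k, (1 - w * y j)⁻¹ ∈ R)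
    (hne : ∀ j < k, 1 - w * y j ≠ 0) :
    ∃ z ∈ R, ∏ j ∈ range k, (1 - w * x j) / (1 - w * y j) =
      1 - w * ∑ j ∈ range k, (x j - y j) + w ^ 2 * z := by
  induction k with
  | zero => exact ⟨0, R.zero_mem, by simp⟩
  | succ k ih =>
    obtain ⟨z, hz, e⟩ := ih (fun j hj => hx j (hj.trans k.lt_succ_self))
      (fun j hj => hy j (hj.trans k.lt_succ_self)) (fun j hj => hinv j (hj.trans k.lt_succ_self))
      (fun j hj => hne j (hj.trans k.lt_succ_self))
    have hX := hx k k.lt_succ_self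
    have hY := hy k k.lt_succ_self
    have hI := hinv k k.lt_succ_self
    have hN := hne k k.lt_succ_self
    have hS : ∑ j ∈ range k, (x j - y j) ∈ R := R.sum_mem fun j hj =>
      R.sub_mem (hx j ((mem_range.1 hj).trans k.lt_succ_self))
        (hy j ((mem_range.1 hj).trans k.lt_succ_self))
    rw [prod_range_succ, sum_range_succ, e]
    generalize ∑ j ∈ range k, (x j - y j) = S at *
    generalize hi : (1 - w * y k)⁻¹ = I at *
    have hd := R.sub_mem hX hY
    -- With d = x k - y k, the new factor is 1 - w d - w² (y k) d I; the witness collects the w²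
    -- part of its product with 1 - w S + w² z.
    refine ⟨S * (x k - y k) + z * (1 - w * (x k - y k)) -
      y k * (x k - y k) * I * (1 - w * S + w ^ 2 * z), ?_, ?_⟩
    · refine R.sub_mem (R.add_mem (R.mul_mem hS hd) (R.mul_mem hz (R.sub_mem R.one_mem
        (R.mul_mem hw hd)))) (R.mul_mem (R.mul_mem (R.mul_mem hY hd) hI) (R.add_mem
        (R.sub_mem R.one_mem (R.mul_mem hw hS)) (R.mul_mem (R.pow_mem hw 2) hz)))
    · have h1 : (1 - w * y k) * I = 1 := by rw [← hi]; exact mul_inv_cancel₀ hN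
      rw [div_eq_mul_inv, hi]
      linear_combination (1 - w * S + w ^ 2 * z) * (1 - w * (x k - y k)) * h1

lemma coprime_of_pos_lt {p a : ℕ} (hp : p.Prime) (h0 : 0 < a) (h : a < p) : a.Coprime p :=
  (Nat.coprime_of_lt_prime h0.ne' h hp).symm

lemma one_div_mem_localIntegers {p a : ℕ} (h : a.Coprime p) : (1 / a : ℚ) ∈ localIntegers p := by
  simpa using nat_div_mem_localIntegers 1 h

lemma one_div_reflect {p a b : ℕ} (hp : p.Prime) (ha : 0 < a) (hb : 0 < b) (hab : a + b = p) :
    RatModEq p (1 / b) (-(1 / a)) := by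
  have h : (p : ℚ) = a + b := by exact_mod_cast hab.symm
  refine ⟨1 / a * (1 / b), (localIntegers p).mul_mem
    (one_div_mem_localIntegers (coprime_of_pos_lt hp ha (by omega)))
    (one_div_mem_localIntegers (coprime_of_pos_lt hp hb (by omega))), ?_⟩
  rw [h]
  have : (a : ℚ) ≠ 0 := by positivity
  have : (b : ℚ) ≠ 0 := by positivity
  field_simp
  ring

/-! ### Reflection i ↦ m - i modulo p -/

section Reflection

variable {p m : ℕ}

lemma thirdRatio_factor_mem (hp : p.Prime) (hm : p = 3 * m + 1) {j : ℕ} (hj : j + 1 < p) :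
    (((j : ℚ) + 1 / 3) / (j + 1)) ∈ localIntegers p := by
  have h3 : Nat.Coprime 3 p := by
    rw [hm]; simp
  have := nat_div_mem_localIntegers (3 * j + 1)
    (Nat.Coprime.mul_left h3 (coprime_of_pos_lt hp j.succ_pos hj))
  convert this using 1
  push_cast
  field_simp

lemma thirdRatio_mem (hp : p.Prime) (hm : p = 3 * m + 1) {i : ℕ} (hi : i < p) :
    thirdRatio i ∈ localIntegers p :=
  (localIntegers p).prod_mem fun j hj => thirdRatio_factor_mem hp hm (by
    have := mem_range.1 hj; omega)

lemma twoThirdRatio_mem (hp : p.Prime) (hm : p = 3 * m + 1) {i : ℕ} (hi : i < p) :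
    twoThirdRatio i ∈ localIntegers p := by
  refine (localIntegers p).prod_mem fun j hj => ?_
  have h3 : Nat.Coprime 3 p := by
    rw [hm]; simp
  have := nat_div_mem_localIntegers (3 * j + 2) (Nat.Coprime.mul_left h3
    (coprime_of_pos_lt hp j.succ_pos (by have := mem_range.1 hj; omega)))
  convert this using 1
  push_cast
  field_simp

/-- The factor at `j = m` is p/(3(m+1)); all the others are integral at p. -/
lemma exists_thirdRatio_eq_mul (hp : p.Prime) (hm : p = 3 * m + 1) {i : ℕ} (hmi : m < i)
    (hi : i < p) : ∃ z ∈ localIntegers p, thirdRatio i = p * z := by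
  have h3 : Nat.Coprime 3 p := by
    rw [hm]; simp
  refine ⟨1 / ((3 * (m + 1) : ℕ) : ℚ) * ∏ j ∈ (range i).erase m, ((j : ℚ) + 1 / 3) / (j + 1),
    (localIntegers p).mul_mem (one_div_mem_localIntegers (Nat.Coprime.mul_left h3
    (coprime_of_pos_lt hp m.succ_pos (by omega)))) ((localIntegers p).prod_mem fun j hj =>
      thirdRatio_factor_mem hp hm (by
        have := mem_range.1 (mem_of_mem_erase hj); omega)), ?_⟩
  rw [thirdRatio, ← mul_prod_erase _ _ (mem_range.2 hmi), ← mul_assoc]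
  congr 1
  rw [hm]
  push_cast
  field_simp

/-- When i + 1 + j = m, 3j+1 ≡ -(3i+3) and 3j+3 ≡ -(3i+1): dividing by a factor at the top amounts
to multiplying by one at the bottom. -/
lemma thirdRatio_reflect (hp : p.Prime) (hm : p = 3 * m + 1) {i j : ℕ} (hij : i + j = m) :
    RatModEq p (thirdRatio j) (thirdRatio m * thirdRatio i) := by
  induction i generalizing j with
  | zero =>
    obtain rfl : j = m := by omega
    simpa [thirdRatio] using RatModEq.refl p (thirdRatio j)
  | succ i ih =>
    have h := ih (j := j + 1) (by omega)
    have h1 : RatModEq p (1 / (3 * j + 1 : ℕ)) (-(1 / (3 * i + 3 : ℕ))) :=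
      one_div_reflect hp (by omega) (by omega) (by omega)
    have h2 : RatModEq p (3 * j + 3 : ℕ) (-(3 * i + 1 : ℕ)) := by
      refine ⟨1, by simp, ?_⟩
      have : (p : ℚ) = 3 * (i + 1 + j) + 1 := by exact_mod_cast (by omega)
      rw [this]; push_cast; ring
    have m1 : (1 / (3 * j + 1 : ℕ) : ℚ) ∈ localIntegers p :=
      one_div_mem_localIntegers (coprime_of_pos_lt hp (by omega) (by omega))
    have m2 : (1 / (3 * i + 3 : ℕ) : ℚ) ∈ localIntegers p :=
      one_div_mem_localIntegers (coprime_of_pos_lt hp (by omega) (by omega))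
    have h4 := h1.mul h2 m1 (neg_mem (natCast_mem _ _))
    have h5 := h.mul h4 (thirdRatio_mem hp hm (by omega))
      (mul_mem (neg_mem m2) (neg_mem (natCast_mem _ _)))
    convert h5 using 1
    · rw [thirdRatio_succ]; push_cast; field_simp
    · rw [thirdRatio_succ]; push_cast; field_simp

/-- The reflection with i = m gives r_m² ≡ 1, so r_m drops out of the sixth power. -/
lemma thirdRatio_pow_six_reflect (hp : p.Prime) (hm : p = 3 * m + 1) {i j : ℕ} (hij : i + j = m) :
    RatModEq p (thirdRatio j ^ 6) (thirdRatio i ^ 6) := by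
  have hM : thirdRatio m ∈ localIntegers p := thirdRatio_mem hp hm (by omega)
  have hI : thirdRatio i ∈ localIntegers p := thirdRatio_mem hp hm (by omega)
  have h1 : RatModEq p (thirdRatio m ^ 2) 1 := by
    have := (thirdRatio_reflect hp hm (i := m) (j := 0) (by omega)).symm
    simpa [thirdRatio, sq] using this
  have h2 := (thirdRatio_reflect hp hm hij).pow (thirdRatio_mem hp hm (by omega))
    (mul_mem hM hI) 6
  have h3 := (h1.pow (pow_mem hM 2) (one_mem _) 3).mul (RatModEq.refl p (thirdRatio i ^ 6))
    (pow_mem (pow_mem hM 2) 3) (pow_mem hI 6)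
  refine h2.trans ?_
  convert h3 using 1 <;> ring

/-- The first order coefficient `∑_{j<i} (1/(3j+1)⁴ - 1/(3j+3)⁴)`. -/
def quarticSum (i : ℕ) : ℚ :=
  ∑ j ∈ range i, ((1 / (3 * j + 1 : ℕ)) ^ 4 - (1 / (3 * j + 3 : ℕ)) ^ 4)

lemma quarticSum_succ (i : ℕ) : quarticSum (i + 1) =
    quarticSum i + ((1 / (3 * i + 1 : ℕ)) ^ 4 - (1 / (3 * i + 3 : ℕ)) ^ 4) := sum_range_succ _ _

lemma quarticSum_mem (hp : p.Prime) (hm : p = 3 * m + 1) {i : ℕ} (hi : i ≤ m) :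
    quarticSum i ∈ localIntegers p := by
  refine sum_mem fun j hj => ?_
  have := mem_range.1 hj
  exact sub_mem
    (pow_mem (one_div_mem_localIntegers (coprime_of_pos_lt hp (by omega) (by omega))) 4)
    (pow_mem (one_div_mem_localIntegers (coprime_of_pos_lt hp (by omega) (by omega))) 4)

/-- The reflection swaps the two kinds of denominators up to sign, which fourth powers ignore. The
case i = m gives 2 `quarticSum m` ≡ 0. -/
lemma quarticSum_reflect_add (hp : p.Prime) (hm : p = 3 * m + 1) {i j : ℕ} (hij : i + j = m) :
    RatModEq p (quarticSum j) (quarticSum m + quarticSum i) := by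
  induction i generalizing j with
  | zero =>
    obtain rfl : j = m := by omega
    simpa [quarticSum] using RatModEq.refl p (quarticSum j)
  | succ i ih =>
    have h := ih (j := j + 1) (by omega)
    have mem {a : ℕ} (h0 : 0 < a) (h1 : a < p) : (1 / a : ℚ) ∈ localIntegers p :=
      one_div_mem_localIntegers (coprime_of_pos_lt hp h0 h1)
    have h1 : RatModEq p ((1 / (3 * j + 1 : ℕ)) ^ 4) ((-(1 / (3 * i + 3 : ℕ))) ^ 4) :=
      (one_div_reflect hp (by omega) (by omega) (by omega)).pow (mem (by omega) (by omega))
        (neg_mem (mem (by omega) (by omega))) 4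
    have h2 : RatModEq p ((1 / (3 * j + 3 : ℕ)) ^ 4) ((-(1 / (3 * i + 1 : ℕ))) ^ 4) :=
      (one_div_reflect hp (by omega) (by omega) (by omega)).pow (mem (by omega) (by omega))
        (neg_mem (mem (by omega) (by omega))) 4
    have h3 := h.sub (h1.sub h2)
    rw [quarticSum_succ] at h3 ⊢
    convert h3 using 1 <;> ring

lemma ratModEq_zero_of_two_mul (hp : p.Prime) (h2 : p ≠ 2) {x : ℚ} (h : RatModEq p (2 * x) 0) :
    RatModEq p x 0 := by
  obtain ⟨z, hz, e⟩ := h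
  have : Nat.Coprime 2 p := coprime_of_pos_lt hp two_pos (lt_of_le_of_ne hp.two_le h2.symm)
  refine ⟨1 / (2 : ℕ) * z, mul_mem (one_div_mem_localIntegers this) hz, ?_⟩
  push_cast
  linear_combination e / 2

/-- For i + j = m, (6i+1) + (6j+1) = 2p, while the other two factors are invariant. The sum is thus
congruent to its own negative, and p is odd. This gains the step from p⁴ to p⁵. -/
lemma sum_thirdRatio_quarticSum (hp : p.Prime) (hm : p = 3 * m + 1) (h2 : p ≠ 2) :
    RatModEq p
      (∑ i ∈ range (m + 1), (6 * (i : ℚ) + 1) * thirdRatio i ^ 6 * quarticSum i) 0 := by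
  have hLm : RatModEq p (quarticSum m) 0 := by
    refine ratModEq_zero_of_two_mul hp h2 ?_
    have := (quarticSum_reflect_add hp hm (i := m) (j := 0) (by omega)).symm
    simpa [quarticSum, two_mul] using this
  refine ratModEq_zero_of_two_mul hp h2 ?_
  rw [two_mul]
  nth_rewrite 1 [← sum_range_reflect]
  rw [← sum_add_distrib]
  refine sum_ratModEq_zero fun i hi => ?_
  obtain ⟨j, hj⟩ := Nat.exists_eq_add_of_le (Nat.lt_succ_iff.1 (mem_range.1 hi))
  have hL : RatModEq p (quarticSum j) (quarticSum i) := by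
    have := (quarticSum_reflect_add hp hm hj.symm).trans (hLm.add (RatModEq.refl p (quarticSum i)))
    rwa [zero_add] at this
  rw [show m + 1 - 1 - i = j by omega]
  have mI : thirdRatio i ^ 6 ∈ localIntegers p := pow_mem (thirdRatio_mem hp hm (by omega)) 6
  have mJ : thirdRatio j ^ 6 ∈ localIntegers p := pow_mem (thirdRatio_mem hp hm (by omega)) 6
  have mL : quarticSum i ∈ localIntegers p := quarticSum_mem hp hm (by omega)
  have h0 : RatModEq p (6 * (j : ℚ) + 1) (-(6 * (i : ℚ) + 1)) := by
    refine ⟨2, ofNat_mem (localIntegers p) 2, ?_⟩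
    rw [hm, hj]; push_cast; ring
  have mj : (6 * (j : ℚ) + 1) ∈ localIntegers p := by exact_mod_cast natCast_mem (localIntegers p) (6 * j + 1)
  have h := ((h0.mul (thirdRatio_pow_six_reflect hp hm hj.symm) mj mI).mul hL (mul_mem mj mJ)
    mL).add (RatModEq.refl p ((6 * (i : ℚ) + 1) * thirdRatio i ^ 6 * quarticSum i))
  convert h using 1
  ring

end Reflection

/-! ### Expansion in powers of p -/

/-- The sum of reciprocal squares `∑_{1≤t≤k} (1/(3t-2)² + 1/(3t)²)`. -/
def quadraticSum (k : ℕ) : ℚ :=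
  ∑ t ∈ Icc 1 k, (1 / (3 * (t : ℚ) - 2) ^ 2 + 1 / (3 * (t : ℚ)) ^ 2)

section Expansion

variable {p m : ℕ}

lemma quadraticSum_def (k : ℕ) : quadraticSum k =
    ∑ t ∈ Icc 1 k, (1 / (3 * (t : ℚ) - 2) ^ 2 + 1 / (3 * (t : ℚ)) ^ 2) := rfl

/-- The double sign gives the shape `x j - y j` of `exists_prod_div_eq`, as the lower factors are 1
+ p²/(3j+3)². -/
lemma quadraticSum_eq (k : ℕ) : quadraticSum k =
    ∑ j ∈ range k, ((1 / (3 * j + 1 : ℕ) : ℚ) ^ 2 - -(1 / (3 * j + 3 : ℕ) : ℚ) ^ 2) := by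
  rw [quadraticSum, ← Ico_add_one_right_eq_Icc, sum_Ico_eq_sum_range]
  refine sum_congr rfl fun j _ => ?_
  push_cast
  rw [show 3 * (1 + (j : ℚ)) - 2 = 3 * j + 1 by ring, show 3 * (1 + (j : ℚ)) = 3 * j + 3 by ring]
  simp

lemma one_div_pow_mem (hp : p.Prime) {a : ℕ} (h0 : 0 < a) (h1 : a < p) (n : ℕ) :
    ((1 / a : ℚ) ^ n) ∈ localIntegers p :=
  pow_mem (one_div_mem_localIntegers (coprime_of_pos_lt hp h0 h1)) n

lemma third_add_sq (hm : p = 3 * m + 1) : ((m : ℚ) + 1 / 3) ^ 2 = (p : ℚ) ^ 2 / 9 := by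
  rw [hm]; push_cast; ring

lemma sq_sub_nine_ne_zero (hm : p = 3 * m + 1) (j : ℕ) : ((j : ℚ) + 1) ^ 2 - (p : ℚ) ^ 2 / 9 ≠ 0 := by
  rw [← third_add_sq hm]; exact sq_sub_ne_zero m j

lemma sq_sub_neg_ne_zero (p j : ℕ) : ((j : ℚ) + 1) ^ 2 - -((p : ℚ) ^ 2 / 9) ≠ 0 := by
  rw [sub_neg_eq_add]; positivity

/-- Opposite parameters ±p²/9 combine by (a² - Z)(a² + Z) = a⁴ - Z², leaving only p⁴. -/
lemma quartic_ratio_eq (hm : p = 3 * m + 1) (i : ℕ) :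
    thirdSqProd ((p : ℚ) ^ 2 / 9) i / oneSqProd ((p : ℚ) ^ 2 / 9) i *
      (thirdSqProd (-((p : ℚ) ^ 2 / 9)) i / oneSqProd (-((p : ℚ) ^ 2 / 9)) i) =
    thirdRatio i ^ 4 * ∏ j ∈ range i, (1 - (p : ℚ) ^ 4 * (1 / (3 * j + 1 : ℕ)) ^ 4) /
      (1 - (p : ℚ) ^ 4 * (1 / (3 * j + 3 : ℕ)) ^ 4) := by
  simp only [thirdSqProd, oneSqProd, thirdRatio]
  rw [← prod_div_distrib, ← prod_div_distrib, ← prod_mul_distrib, ← prod_pow, ← prod_mul_distrib]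
  refine prod_congr rfl fun j _ => ?_
  have h1 := sq_sub_nine_ne_zero hm j
  have h2 := sq_sub_neg_ne_zero p j
  have hj : (j : ℚ) + 1 ≠ 0 := by positivity
  have hj' : 3 * (j : ℚ) + 1 ≠ 0 := by positivity
  have e1 : 1 - (p : ℚ) ^ 4 * (1 / (3 * j + 1 : ℕ)) ^ 4 =
      (((j : ℚ) + 1 / 3) ^ 2 - (p : ℚ) ^ 2 / 9) * (((j : ℚ) + 1 / 3) ^ 2 - -((p : ℚ) ^ 2 / 9)) /
        ((j : ℚ) + 1 / 3) ^ 4 := by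
    push_cast; field_simp; ring
  have e2 : 1 - (p : ℚ) ^ 4 * (1 / (3 * j + 3 : ℕ)) ^ 4 =
      (((j : ℚ) + 1) ^ 2 - (p : ℚ) ^ 2 / 9) * (((j : ℚ) + 1) ^ 2 - -((p : ℚ) ^ 2 / 9)) /
        ((j : ℚ) + 1) ^ 4 := by
    push_cast
    rw [show 3 * (j : ℚ) + 3 = 3 * (j + 1) by ring]
    field_simp; ring
  have hj3 : (j : ℚ) + 1 / 3 ≠ 0 := by positivity
  rw [e1, e2]
  generalize ((j : ℚ) + 1) ^ 2 - (p : ℚ) ^ 2 / 9 = a at *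
  generalize ((j : ℚ) + 1) ^ 2 - -((p : ℚ) ^ 2 / 9) = b at *
  generalize (j : ℚ) + 1 / 3 = c at *
  generalize (j : ℚ) + 1 = d at *
  field_simp

lemma quadratic_ratio_eq (p k : ℕ) :
    thirdSqProd ((p : ℚ) ^ 2 / 9) k / oneSqProd (-((p : ℚ) ^ 2 / 9)) k =
    thirdRatio k ^ 2 * ∏ j ∈ range k, (1 - (p : ℚ) ^ 2 * (1 / (3 * j + 1 : ℕ)) ^ 2) /
      (1 - (p : ℚ) ^ 2 * -(1 / (3 * j + 3 : ℕ)) ^ 2) := by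
  simp only [thirdSqProd, oneSqProd, thirdRatio]
  rw [← prod_div_distrib, ← prod_pow, ← prod_mul_distrib]
  refine prod_congr rfl fun j _ => ?_
  have h2 := sq_sub_neg_ne_zero p j
  have hj : (j : ℚ) + 1 ≠ 0 := by positivity
  have hj3 : (j : ℚ) + 1 / 3 ≠ 0 := by positivity
  have e1 : 1 - (p : ℚ) ^ 2 * (1 / (3 * j + 1 : ℕ)) ^ 2 =
      (((j : ℚ) + 1 / 3) ^ 2 - (p : ℚ) ^ 2 / 9) / ((j : ℚ) + 1 / 3) ^ 2 := by
    push_cast; field_simp; ring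
  have e2 : 1 - (p : ℚ) ^ 2 * -(1 / (3 * j + 3 : ℕ)) ^ 2 =
      (((j : ℚ) + 1) ^ 2 - -((p : ℚ) ^ 2 / 9)) / ((j : ℚ) + 1) ^ 2 := by
    push_cast
    rw [show 3 * (j : ℚ) + 3 = 3 * (j + 1) by ring]
    field_simp; ring
  rw [e1, e2]
  generalize ((j : ℚ) + 1) ^ 2 - -((p : ℚ) ^ 2 / 9) = b at *
  generalize (j : ℚ) + 1 / 3 = c at *
  generalize (j : ℚ) + 1 = d at *
  field_simp

lemma one_sub_ne_zero_of_inv {s : ℚ} (hp : p.Prime) (hs : s ∈ localIntegers p) :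
    1 - p * s ≠ 0 := fun h => by
  have h1 : s = 1 / p := by
    have : (p : ℚ) ≠ 0 := by exact_mod_cast hp.ne_zero
    field_simp; linarith
  have h2 : s.den = p := by
    rw [h1, one_div, Rat.inv_natCast_den_of_pos hp.pos]
  have h3 := mem_localIntegers.1 hs
  rw [h2, Nat.coprime_self] at h3
  exact hp.one_lt.ne' h3

lemma exists_quartic_ratio_eq (hp : p.Prime) (hm : p = 3 * m + 1) {i : ℕ} (hi : i ≤ m) :
    ∃ z ∈ localIntegers p,
      thirdSqProd ((p : ℚ) ^ 2 / 9) i / oneSqProd ((p : ℚ) ^ 2 / 9) i *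
        (thirdSqProd (-((p : ℚ) ^ 2 / 9)) i / oneSqProd (-((p : ℚ) ^ 2 / 9)) i) =
      thirdRatio i ^ 4 * (1 - (p : ℚ) ^ 4 * quarticSum i + (p : ℚ) ^ 8 * z) := by
  have hw : (p : ℚ) ^ 3 ∈ localIntegers p := pow_mem (natCast_mem _ p) 3
  have hy (j : ℕ) (hj : j < i) : (1 / (3 * j + 3 : ℕ) : ℚ) ^ 4 ∈ localIntegers p :=
    one_div_pow_mem hp (by omega) (by omega) 4
  have he (a : ℚ) : 1 - (p : ℚ) ^ 4 * a = 1 - p * (p ^ 3 * a) := by ring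
  obtain ⟨z, hz, e⟩ := exists_prod_div_eq (localIntegers p) (w := (p : ℚ) ^ 4)
    (x := fun j => (1 / (3 * j + 1 : ℕ) : ℚ) ^ 4) (y := fun j => (1 / (3 * j + 3 : ℕ) : ℚ) ^ 4)
    (k := i) (pow_mem (natCast_mem _ p) 4)
    (fun j hj => one_div_pow_mem hp (by omega) (by omega) 4) hy
    (fun j hj => by rw [he]; exact inv_one_sub_mem_localIntegers (mul_mem hw (hy j hj)))
    (fun j hj => by rw [he]; exact one_sub_ne_zero_of_inv hp (mul_mem hw (hy j hj)))
  refine ⟨z, hz, ?_⟩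
  rw [quartic_ratio_eq hm, e, quarticSum]
  ring

lemma quadraticSum_mem (hp : p.Prime) (hm : p = 3 * m + 1) {k : ℕ} (hk : k ≤ m) :
    quadraticSum k ∈ localIntegers p := by
  rw [quadraticSum_eq]
  refine sum_mem fun j hj => ?_
  have := mem_range.1 hj
  exact sub_mem (one_div_pow_mem hp (by omega) (by omega) 2)
    (neg_mem (one_div_pow_mem hp (by omega) (by omega) 2))

lemma exists_quadratic_ratio_eq (hp : p.Prime) (hm : p = 3 * m + 1) {k : ℕ} (hk : k ≤ m) :
    ∃ z ∈ localIntegers p,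
      thirdSqProd ((p : ℚ) ^ 2 / 9) k / oneSqProd (-((p : ℚ) ^ 2 / 9)) k =
      thirdRatio k ^ 2 * (1 - (p : ℚ) ^ 2 * quadraticSum k + (p : ℚ) ^ 4 * z) := by
  have hw : (p : ℚ) ∈ localIntegers p := natCast_mem _ p
  have hy (j : ℕ) (hj : j < k) : -(1 / (3 * j + 3 : ℕ) : ℚ) ^ 2 ∈ localIntegers p :=
    neg_mem (one_div_pow_mem hp (by omega) (by omega) 2)
  have he (a : ℚ) : 1 - (p : ℚ) ^ 2 * a = 1 - p * (p * a) := by ring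
  obtain ⟨z, hz, e⟩ := exists_prod_div_eq (localIntegers p) (w := (p : ℚ) ^ 2)
    (x := fun j => (1 / (3 * j + 1 : ℕ) : ℚ) ^ 2) (y := fun j => -(1 / (3 * j + 3 : ℕ) : ℚ) ^ 2)
    (k := k) (pow_mem (natCast_mem _ p) 2)
    (fun j hj => one_div_pow_mem hp (by omega) (by omega) 2) hy
    (fun j hj => by rw [he]; exact inv_one_sub_mem_localIntegers (mul_mem hw (hy j hj)))
    (fun j hj => by rw [he]; exact one_sub_ne_zero_of_inv hp (mul_mem hw (hy j hj)))
  refine ⟨z, hz, ?_⟩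
  rw [quadratic_ratio_eq, e, ← quadraticSum_eq]
  ring

/-- The single sum modulo `p ^ 5`. -/
theorem exists_single_sum_eq (hp : p.Prime) (hm : p = 3 * m + 1) (h2 : p ≠ 2) :
    ∃ z ∈ localIntegers p,
      ∑ i ∈ range (m + 1), (6 * (i : ℚ) + 1) * thirdRatio i ^ 6 =
        p * twoThirdRatio m * ((∑ k ∈ range (m + 1), thirdRatio k ^ 3) -
          (p : ℚ) ^ 2 * ∑ k ∈ range (m + 1), thirdRatio k ^ 3 * quadraticSum k) + p ^ 5 * z := by
  -- Termination forces the first parameter to be p²/9; taking `Z = -p²/9` cancels the p² terms on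
  -- the left side.
  have hW := whipple_third m (sq_sub_neg_ne_zero p)
  rw [third_add_sq hm] at hW
  obtain ⟨t, ht, et⟩ := sum_thirdRatio_quarticSum hp hm h2
  have hlt {i : ℕ} (hi : i ∈ range (m + 1)) : i ≤ m := Nat.lt_succ_iff.1 (mem_range.1 hi)
  choose! u hu eu using fun i (hi : i ≤ m) => exists_quartic_ratio_eq hp hm hi
  choose! v hv ev using fun i (hi : i ≤ m) => exists_quadratic_ratio_eq hp hm hi
  have hr {i : ℕ} (hi : i ∈ range (m + 1)) : thirdRatio i ∈ localIntegers p :=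
    thirdRatio_mem hp hm (by have := hlt hi; omega)
  have hL : ∑ i ∈ range (m + 1), (6 * (i : ℚ) + 1) * (thirdRatio i ^ 2 *
        (thirdSqProd ((p : ℚ) ^ 2 / 9) i / oneSqProd ((p : ℚ) ^ 2 / 9) i)) *
        (thirdSqProd (-((p : ℚ) ^ 2 / 9)) i / oneSqProd (-((p : ℚ) ^ 2 / 9)) i) =
      ∑ i ∈ range (m + 1), (6 * (i : ℚ) + 1) * thirdRatio i ^ 6 -
        (p : ℚ) ^ 4 * ∑ i ∈ range (m + 1), (6 * (i : ℚ) + 1) * thirdRatio i ^ 6 * quarticSum i +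
        (p : ℚ) ^ 8 * ∑ i ∈ range (m + 1), (6 * (i : ℚ) + 1) * thirdRatio i ^ 6 * u i := by
    rw [mul_sum, mul_sum, ← sum_sub_distrib, ← sum_add_distrib]
    refine sum_congr rfl fun i hi => ?_
    linear_combination (6 * (i : ℚ) + 1) * thirdRatio i ^ 2 * eu i (hlt hi)
  have hRt : ∑ k ∈ range (m + 1), thirdRatio k * (thirdSqProd ((p : ℚ) ^ 2 / 9) k /
          oneSqProd (-((p : ℚ) ^ 2 / 9)) k) =
      (∑ k ∈ range (m + 1), thirdRatio k ^ 3) -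
        (p : ℚ) ^ 2 * (∑ k ∈ range (m + 1), thirdRatio k ^ 3 * quadraticSum k) +
        (p : ℚ) ^ 4 * ∑ k ∈ range (m + 1), thirdRatio k ^ 3 * v k := by
    rw [mul_sum, mul_sum, ← sum_sub_distrib, ← sum_add_distrib]
    refine sum_congr rfl fun k hk => ?_
    linear_combination thirdRatio k * ev k (hlt hk)
  have hU : ∑ i ∈ range (m + 1), (6 * (i : ℚ) + 1) * thirdRatio i ^ 6 * u i ∈ localIntegers p :=
    sum_mem fun i hi => mul_mem (mul_mem (by exact_mod_cast natCast_mem (localIntegers p) (6 * i + 1))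
      (pow_mem (hr hi) 6)) (hu i (hlt hi))
  have hV : ∑ k ∈ range (m + 1), thirdRatio k ^ 3 * v k ∈ localIntegers p :=
    sum_mem fun i hi => mul_mem (pow_mem (hr hi) 3) (hv i (hlt hi))
  have hC : twoThirdRatio m ∈ localIntegers p := twoThirdRatio_mem hp hm (by omega)
  have hpm : (3 * (m : ℚ) + 1) = p := by rw [hm]; push_cast; ring
  rw [hL, hRt, hpm] at hW
  -- The p⁴ error on the right gains a p from 3m + 1 = p, the p⁴ term on the left gains one from the
  -- reflection, and p⁸ exceeds p⁵ by p³.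
  refine ⟨_, add_mem (sub_mem (mul_mem hC hV) (mul_mem (pow_mem (natCast_mem _ p) 3) hU)) ht, ?_⟩
  linear_combination hW + (p : ℚ) ^ 4 * et

/-- Since 2m ≤ p - 1, the square of indices up to m fits in the triangle; any other pair has an
index above m, whose sixth power supplies p⁶. -/
lemma exists_double_sum_eq (hp : p.Prime) (hm : p = 3 * m + 1) :
    ∃ z ∈ localIntegers p,
      ∑ ij ∈ range p ×ˢ range p with ij.1 + ij.2 ≤ p - 1,
        ((6 * (ij.1 : ℚ) + 1) * thirdRatio ij.1 ^ 6) *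
          ((6 * (ij.2 : ℚ) + 1) * thirdRatio ij.2 ^ 6) =
      (∑ i ∈ range (m + 1), (6 * (i : ℚ) + 1) * thirdRatio i ^ 6) ^ 2 + p ^ 6 * z := by
  set f : ℕ → ℚ := fun i => (6 * (i : ℚ) + 1) * thirdRatio i ^ 6 with hf
  have hfm {i : ℕ} (hi : i < p) : f i ∈ localIntegers p :=
    mul_mem (by exact_mod_cast natCast_mem (localIntegers p) (6 * i + 1))
      (pow_mem (thirdRatio_mem hp hm hi) 6)
  have hfd {i : ℕ} (hi : i < p) (hmi : m < i) : ∃ z ∈ localIntegers p, f i = p ^ 6 * z := by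
    obtain ⟨z, hz, e⟩ := exists_thirdRatio_eq_mul hp hm hmi hi
    refine ⟨(6 * (i : ℚ) + 1) * z ^ 6, mul_mem
      (by exact_mod_cast natCast_mem (localIntegers p) (6 * i + 1)) (pow_mem hz 6), ?_⟩
    simp only [hf]
    rw [e]; ring
  have hsub : range (m + 1) ×ˢ range (m + 1) ⊆
      (range p ×ˢ range p).filter fun ij => ij.1 + ij.2 ≤ p - 1 := by
    intro ij h
    simp only [mem_product, mem_range, mem_filter] at h ⊢
    omega
  have hz : ∀ ij ∈ ((range p ×ˢ range p).filter fun ij => ij.1 + ij.2 ≤ p - 1) \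
      (range (m + 1) ×ˢ range (m + 1)), ∃ z ∈ localIntegers p, f ij.1 * f ij.2 = p ^ 6 * z := by
    intro ij h
    simp only [mem_sdiff, mem_product, mem_range, mem_filter] at h
    by_cases h1 : ij.1 < m + 1
    · obtain ⟨z, hz, e⟩ := hfd h.1.1.2 (by omega)
      exact ⟨f ij.1 * z, mul_mem (hfm h.1.1.1) hz, by rw [e]; ring⟩
    · obtain ⟨z, hz, e⟩ := hfd h.1.1.1 (by omega)
      exact ⟨z * f ij.2, mul_mem hz (hfm h.1.1.2), by rw [e]; ring⟩
  choose! z hz ez using hz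
  refine ⟨_, sum_mem hz, ?_⟩
  rw [← sum_sdiff hsub, sum_congr rfl ez, ← mul_sum, sq, sum_mul_sum, ← sum_product', add_comm]

end Expansion

/-! ### Return to shifted factorials and conclusion -/

lemma shiftedFactorial_eq_prod (x : ℚ) (n : ℕ) :
    shiftedFactorial x n = ∏ j ∈ range n, (x + j) := by
  induction n with
  | zero => simp [shiftedFactorial]
  | succ n ih =>
    rw [prod_range_succ, ← ih, shiftedFactorial, ascPochhammer_succ_eval, shiftedFactorial]

lemma shiftedFactorial_third_div (n : ℕ) :
    shiftedFactorial (1 / 3) n / shiftedFactorial 1 n = thirdRatio n := by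
  rw [shiftedFactorial_eq_prod, shiftedFactorial_eq_prod, ← prod_div_distrib, thirdRatio]
  exact prod_congr rfl fun j _ => by rw [add_comm, add_comm (1 : ℚ)]

lemma shiftedFactorial_twoThird_div (n : ℕ) :
    shiftedFactorial (2 / 3) n / shiftedFactorial 1 n = twoThirdRatio n := by
  rw [shiftedFactorial_eq_prod, shiftedFactorial_eq_prod, ← prod_div_distrib, twoThirdRatio]
  exact prod_congr rfl fun j _ => by rw [add_comm, add_comm (1 : ℚ)]

theorem mainTheorem10 (p : ℕ) (hp : p.Prime) (hp6 : p ≡ 1 [MOD 6]) :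
    RatModEq (p ^ 6)
      (∑ ij ∈ Finset.range p ×ˢ Finset.range p with ij.1 + ij.2 ≤ p - 1,
        (6 * (ij.1 : ℚ) + 1) * (6 * (ij.2 : ℚ) + 1) *
          ((shiftedFactorial (1 / 3) ij.1 ^ 6 * shiftedFactorial (1 / 3) ij.2 ^ 6) /
            (shiftedFactorial 1 ij.1 ^ 6 * shiftedFactorial 1 ij.2 ^ 6)))
      ((p : ℚ) ^ 2 *
        (shiftedFactorial (2 / 3) ((p - 1) / 3) ^ 2 / shiftedFactorial 1 ((p - 1) / 3) ^ 2) *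
        (∑ k ∈ Finset.range ((p - 1) / 3 + 1),
          shiftedFactorial (1 / 3) k ^ 3 / shiftedFactorial 1 k ^ 3) *
        (∑ k ∈ Finset.range ((p - 1) / 3 + 1),
          shiftedFactorial (1 / 3) k ^ 3 / shiftedFactorial 1 k ^ 3 *
            (1 - 2 * (p : ℚ) ^ 2 *
              ∑ t ∈ Finset.Icc 1 k,
                (1 / (3 * (t : ℚ) - 2) ^ 2 + 1 / (3 * (t : ℚ)) ^ 2)))) := by
  have hmod : p % 6 = 1 := hp6
  obtain ⟨m, hm⟩ : ∃ m, p = 3 * m + 1 := ⟨p / 3, by omega⟩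
  have h2 : p ≠ 2 := by omega
  rw [show (p - 1) / 3 = m by omega]
  obtain ⟨a, ha, ea⟩ := exists_double_sum_eq hp hm
  obtain ⟨b, hb, eb⟩ := exists_single_sum_eq hp hm h2
  have hlt {i : ℕ} (hi : i ∈ range (m + 1)) : i ≤ m := Nat.lt_succ_iff.1 (mem_range.1 hi)
  have hr {i : ℕ} (hi : i ∈ range (m + 1)) : thirdRatio i ^ 3 ∈ localIntegers p :=
    pow_mem (thirdRatio_mem hp hm (by have := hlt hi; omega)) 3
  have hA : ∑ k ∈ range (m + 1), thirdRatio k ^ 3 ∈ localIntegers p := sum_mem fun k hk => hr hk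
  have hD : ∑ k ∈ range (m + 1), thirdRatio k ^ 3 * quadraticSum k ∈ localIntegers p :=
    sum_mem fun k hk => mul_mem (hr hk) (quadraticSum_mem hp hm (hlt hk))
  have hC : twoThirdRatio m ∈ localIntegers p := twoThirdRatio_mem hp hm (by omega)
  have hl : ∑ ij ∈ range p ×ˢ range p with ij.1 + ij.2 ≤ p - 1,
        (6 * (ij.1 : ℚ) + 1) * (6 * (ij.2 : ℚ) + 1) *
          ((shiftedFactorial (1 / 3) ij.1 ^ 6 * shiftedFactorial (1 / 3) ij.2 ^ 6) /
            (shiftedFactorial 1 ij.1 ^ 6 * shiftedFactorial 1 ij.2 ^ 6)) =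
      ∑ ij ∈ range p ×ˢ range p with ij.1 + ij.2 ≤ p - 1,
        ((6 * (ij.1 : ℚ) + 1) * thirdRatio ij.1 ^ 6) *
          ((6 * (ij.2 : ℚ) + 1) * thirdRatio ij.2 ^ 6) := by
    refine sum_congr rfl fun ij _ => ?_
    rw [mul_div_mul_comm, ← div_pow, ← div_pow, shiftedFactorial_third_div,
      shiftedFactorial_third_div]
    ring
  have hW : ∑ k ∈ range (m + 1), thirdRatio k ^ 3 * (1 - 2 * (p : ℚ) ^ 2 * quadraticSum k) =
      (∑ k ∈ range (m + 1), thirdRatio k ^ 3) -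
        2 * p ^ 2 * ∑ k ∈ range (m + 1), thirdRatio k ^ 3 * quadraticSum k := by
    rw [mul_sum, ← sum_sub_distrib]
    exact sum_congr rfl fun k _ => by ring
  simp only [← quadraticSum_def]
  simp only [← div_pow, shiftedFactorial_third_div, shiftedFactorial_twoThird_div]
  rw [hl, ea, eb, hW]
  have hP : (p : ℚ) ∈ localIntegers p := natCast_mem _ p
  generalize ∑ k ∈ range (m + 1), thirdRatio k ^ 3 = A at *
  generalize ∑ k ∈ range (m + 1), thirdRatio k ^ 3 * quadraticSum k = D at *
  generalize twoThirdRatio m = C at *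
  -- `C² D²` is the defect in (A - p²D)² = A(A - 2p²D) + p⁴D²; the terms in `b` come from squaring
  -- the p⁵ error, whose cross term gains a p from the main term.
  refine ⟨C ^ 2 * D ^ 2 + 2 * C * (A - p ^ 2 * D) * b + p ^ 4 * b ^ 2 + a, ?_, ?_⟩
  · exact Nat.Coprime.pow_right 6 (mem_localIntegers.1 (add_mem (add_mem (add_mem (mul_mem (pow_mem hC 2)
      (pow_mem hD 2)) (mul_mem (mul_mem (mul_mem (ofNat_mem _ 2) hC)
      (sub_mem hA (mul_mem (pow_mem hP 2) hD))) hb)) (mul_mem (pow_mem hP 4) (pow_mem hb 2))) ha))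
  · push_cast
    ring
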